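/- Let $\mathcal Y$ (actions) and $\mathcal O$ (observations) be measurable spaces and let $\mathcal X=\mathcal O\times[0,1]$, so that a perception $x_t=(o_t,r_t)$ consists of an observation $o_t$ and a reward $r_t\in[0,1]$. Fix a policy $\pi$, given by probability kernels $\pi(dy_t\mid x_{<t}y_{<t})$, and a countable (finite or infinite) class of environments $\{\nu_1,\nu_2,\dots\}$, each given by probability kernels $\nu_i(dx_t\mid x_{<t}y_{1:t})$; no Markov, stationarity, ergodicity or other assumption is made. Let the true environment $\mu$ belong to the class. Let $Q_i$ be the joint law of the infinite interaction sequence $y_1x_1y_2x_2\dots$ of $\pi$ with $\nu_i$, and let $P$ be that of $\pi$ with $\mu$. Write $x=x_{1:\ell}$, $y=y_{1:\ell}$ for the first $\ell$ perceptions and actions, and let $Q_i[\,\cdot\mid xy]$ be the law of the interaction of $\pi$ with $\nu_i$ continued from the history $xy$. Let $$Q_i(x\mid y)=\prod_{t=1}^{\ell}\nu_i(x_t\mid x_{<t}y_{1:t}),$$ where $\nu_i(x_t\mid x_{<t}y_{1:t})$ is the probability of $x_t$ if $\mathcal X$ is replaced by a countable set of perceptions, and in general a jointly measurable density of $\nu_i(dx_t\mid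 x_{<t}y_{1:t})$ with respect to an s-finite reference kernel common to all $i$. Let the complexities $K(Q_i)\in\mathbb R$ satisfy $\sum_i 2^{-K(Q_i)}<\infty$, and let $$\mathrm{MDL}^{x|y}\in\arg\min_{Q_i}\{-\log_2 Q_i(x\mid y)+K(Q_i)\}.$$ For $0\le\gamma<1$ let $$V_{Q_i}[xy]=\mathbf E_{Q_i[\cdot\mid xy]}\big[r_{\ell+1}+\gamma r_{\ell+2}+\gamma^2r_{\ell+3}+\cdots\big]$$ be the expected future $\gamma$-discounted reward sum, and similarly $V_P[xy]$ for $P$. Then, for every policy $\pi$, with $P$-probability $1$ a minimizer $\mathrm{MDL}^{x|y}$ exists for every $\ell$ and, whichever minimizers are chosen, $$V_{\mathrm{MDL}^{x|y}}[xy]-V_P[xy]\longrightarrow 0\qquad(\ell\to\infty).$$ -/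

import Mathlib

open MeasureTheory ProbabilityTheory Filter Topology
open scoped ENNReal

/-- A perception `x = (o, r)`: a regular observation `o` and a reward `r ∈ [0,1]`. -/
abbrev Percept (O : Type*) := O × unitInterval

/-- One interaction cycle `(y, x)`: an action followed by a perception. -/
abbrev InteractionCycle (Y O : Type*) := Y × Percept O

/-- An interaction history consisting of `t` complete cycles. -/
abbrev History (Y O : Type*) (t : ℕ) := Fin t → InteractionCycle Y O

/-- An infinite interaction sequence; the cycles are numbered `0, 1, 2, …`. -/
abbrev Trajectory (Y O : Type*) := ℕ → InteractionCycle Y O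

/-- A (stochastic, history dependent) policy: given the past cycles, it draws the next action. -/
structure Policy (Y O : Type*) [MeasurableSpace Y] [MeasurableSpace O] where
  act : ∀ t : ℕ, Kernel (History Y O t) Y
  markov : ∀ t, IsMarkovKernel (act t)

/-- A (stochastic, history dependent) environment: given the past cycles and the current action,
it draws the next perception. -/
structure Environment (Y O : Type*) [MeasurableSpace Y] [MeasurableSpace O] where
  perceive : ∀ t : ℕ, Kernel (History Y O t × Y) (Percept O)
  markov : ∀ t, IsMarkovKernel (perceive t)

attribute [instance] Policy.markov Environment.markov

section Interaction

variable {Y O : Type*} [MeasurableSpace Y] [MeasurableSpace O]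

/-- The first `t` cycles of an infinite interaction sequence. -/
def firstCycles (ω : Trajectory Y O) (t : ℕ) : History Y O t := fun i => ω i

/-- Cycles `0, …, n` indexed by `Finset.Iic n`, read as a history of `n + 1` cycles. -/
def toHistory (n : ℕ) (h : (i : Finset.Iic n) → InteractionCycle Y O) : History Y O (n + 1) :=
  fun i => h ⟨i, Finset.mem_Iic.2 (Nat.lt_succ_iff.1 i.2)⟩

/-- A history of `n + 1` cycles, read as a family indexed by `Finset.Iic n`. -/
def ofHistory (n : ℕ) (h : History Y O (n + 1)) : (i : Finset.Iic n) → InteractionCycle Y O :=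
  fun i => h ⟨i, Nat.lt_succ_iff.2 (Finset.mem_Iic.1 i.2)⟩

theorem measurable_toHistory (n : ℕ) : Measurable (toHistory (Y := Y) (O := O) n) :=
  measurable_pi_lambda _ fun _ => measurable_pi_apply _

theorem measurable_ofHistory (n : ℕ) : Measurable (ofHistory (Y := Y) (O := O) n) :=
  measurable_pi_lambda _ fun _ => measurable_pi_apply _

noncomputable section

/-- The law of the next cycle given a history of `t` cycles: first the action is drawn from the
policy, then the perception from the environment. -/
def cycleKernel (π : Policy Y O) (ν : Environment Y O) (t : ℕ) :
    Kernel (History Y O t) (InteractionCycle Y O) :=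
  π.act t ⊗ₖ ν.perceive t

instance (π : Policy Y O) (ν : Environment Y O) (t : ℕ) : IsMarkovKernel (cycleKernel π ν t) := by
  unfold cycleKernel; infer_instance

/-- The same transition kernel in the indexing of the Ionescu-Tulcea construction. -/
def stepKernel (π : Policy Y O) (ν : Environment Y O) (n : ℕ) :
    Kernel ((i : Finset.Iic n) → InteractionCycle Y O) (InteractionCycle Y O) :=
  (cycleKernel π ν (n + 1)).comap (toHistory n) (measurable_toHistory n)

instance (π : Policy Y O) (ν : Environment Y O) (n : ℕ) : IsMarkovKernel (stepKernel π ν n) := by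
  unfold stepKernel; infer_instance

/-- The predictive distribution: the law of the whole infinite interaction of `π` with `ν`,
given that its first `ℓ` cycles are the given history. -/
def predictive (π : Policy Y O) (ν : Environment Y O) :
    (ℓ : ℕ) → Kernel (History Y O ℓ) (Trajectory Y O)
  | 0 => Kernel.traj (X := fun _ => InteractionCycle Y O) (stepKernel π ν) 0 ∘ₖ
      (cycleKernel π ν 0).map (fun c (_ : Finset.Iic 0) => c)
  | n + 1 => (Kernel.traj (X := fun _ => InteractionCycle Y O) (stepKernel π ν) n).comap
      (ofHistory n) (measurable_ofHistory n)

/-- The joint law on infinite interaction sequences of the policy `π` and the environment `ν`. -/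
def interactionLaw (π : Policy Y O) (ν : Environment Y O) : Measure (Trajectory Y O) :=
  predictive π ν 0 Fin.elim0

/-- The value of `π` in `ν` after the history `h` of `ℓ` cycles: the expectation, under the
predictive distribution given `h`, of the discounted sum of the rewards received after `h`. -/
def value (γ : ℝ) (π : Policy Y O) (ν : Environment Y O) (ℓ : ℕ) (h : History Y O ℓ) : ℝ :=
  ∫ ω, ∑' k : ℕ, γ ^ k * ((ω (ℓ + k)).2.2 : ℝ) ∂(predictive π ν ℓ h)

/-- The law of the first `t` cycles together with the next action. -/
def pastActionLaw (π : Policy Y O) (ν : Environment Y O) (t : ℕ) :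
    Measure (History Y O t × Y) :=
  ((interactionLaw π ν).map (fun ω => firstCycles ω t)) ⊗ₘ π.act t

/-- `q t` is a jointly measurable density of the perception probabilities of `ν` in cycle `t`
with respect to the reference kernel `ref t`, along the interaction of `π` with `ν`. This holds for
any jointly measurable `q` such that `q t (a, ·)` is a density of `ν.perceive t a` with respect to
`ref t a` for all `a`; the integrated form leaves versions of densities free on null sets and does
not need the spaces to be countably generated. -/
structure IsEnvDensity (π : Policy Y O) (ν : Environment Y O)
    (ref : ∀ t : ℕ, Kernel (History Y O t × Y) (Percept O))
    (q : ∀ t : ℕ, (History Y O t × Y) × Percept O → ℝ≥0∞) : Prop where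
  measurable : ∀ t, Measurable (q t)
  density : ∀ t, pastActionLaw π ν t ⊗ₘ ν.perceive t =
    (pastActionLaw π ν t ⊗ₘ ref t).withDensity (q t)

/-- `Q(x|y) = ∏ₜ q(xₜ | x_{<t} y_{≤t})` for a history of `ℓ` cycles. -/
def condDensity (q : ∀ t : ℕ, (History Y O t × Y) × Percept O → ℝ≥0∞) (ℓ : ℕ)
    (h : History Y O ℓ) : ℝ≥0∞ :=
  ∏ t : Fin ℓ, q t ((fun s : Fin t => h (Fin.castLE t.isLt.le s), (h t).1), (h t).2)

/-- The two-part codelength `-log₂ Q(x|y) + K(Q)`. -/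
def codelength (q : ∀ t : ℕ, (History Y O t × Y) × Percept O → ℝ≥0∞) (K : ℝ) (ℓ : ℕ)
    (h : History Y O ℓ) : EReal :=
  -(ENNReal.log (condDensity q ℓ h) / ((Real.log 2 : ℝ) : EReal)) + (K : EReal)

/-- `i` is an index selected by MDL after the history `h`: it minimizes the two-part codelength
over the class. -/
def IsMDL {ι : Type*} (q : ι → ∀ t : ℕ, (History Y O t × Y) × Percept O → ℝ≥0∞) (K : ι → ℝ)
    (ℓ : ℕ) (h : History Y O ℓ) (i : ι) : Prop :=
  ∀ j : ι, codelength (q i) (K i) ℓ h ≤ codelength (q j) (K j) ℓ h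

end

end Interaction

/-! Write `P` and `Q` for the laws of the interaction with the true environment and with one
competitor, and `a n`, `b n` for their likelihoods on the first `n` cycles. The policy enters both
laws in the same way, so the product of the perception densities alone is the likelihood, relative
to the interaction of the policy with the reference kernels (`map_firstCycles_eq_withDensity`).

A single competitor either predicts well or is refuted. Let `M = P + Q`, with `p`, `q` the densities
of `P`, `Q` with respect to `M`. Their conditional expectations given `n` cycles are `a n / (a n + b
n)` and `b n / (a n + b n)`, and converge to `p` and `q` by Lévy's upward theorem; moreover `p > 0`
holds `P`-almost surely. Where `q > 0`, both densities are asymptotically known from the past, so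
conditional expectations of uniformly bounded quantities under `P` and `Q` approach the same
`M`-conditional expectation (`tendsto_sub_of_condExp_mul`). Where `q = 0`, the ratio `b n / a n`
tends to zero, so no fixed complexity advantage saves the competitor. This is
`merging_or_likelihoodRatio_tendsto_zero`; no absolute continuity between `P` and `Q` is needed.

A countable class needs uniformity. By `measure_exists_mul_density_le`, a competitor of weight `w'`
ever ties with or beats the truth of weight `w` with probability at most `w' / w`. The weights `2 ^
(-K i)` are summable, so by Borel–Cantelli only finitely many competitors ever do. Hence minimizers
exist, the choices remain in a finite random set, and the dichotomy applies to all its members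
simultaneously. -/

/-! ### Merging of conditional expectations under two dominated measures. -/

section Merging

variable {Ω : Type*} {m0 : MeasurableSpace Ω}

/-- The conditional `L¹` distance of `g` to its conditional expectations vanishes in the limit. -/
theorem tendsto_condExp_abs_sub_condExp (M : Measure Ω) [IsFiniteMeasure M] (ℱ : Filtration ℕ m0)
    {g : Ω → ℝ} (hg : Integrable g M) (hgm : StronglyMeasurable[⨆ n, ℱ n] g) :
    ∀ᵐ ω ∂M, Tendsto (fun n => (M[fun x => |g x - (M[g | ℱ n]) x| | ℱ n]) ω) atTop (𝓝 0) := by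
  have hsub : ∀ m, Integrable (fun x => |g x - (M[g | ℱ m]) x|) M := fun m =>
    (hg.sub integrable_condExp).abs
  have h1 : ∀ᵐ ω ∂M, Tendsto (fun n => (M[g | ℱ n]) ω) atTop (𝓝 (g ω)) :=
    hg.tendsto_ae_condExp hgm
  have h2 : ∀ᵐ ω ∂M, ∀ m, Tendsto (fun n => (M[fun x => |g x - (M[g | ℱ m]) x| | ℱ n]) ω) atTop
      (𝓝 |g ω - (M[g | ℱ m]) ω|) := by
    refine ae_all_iff.2 fun m => (hsub m).tendsto_ae_condExp ?_
    exact (hgm.sub (stronglyMeasurable_condExp.mono (le_iSup (fun n => ℱ n) m))).norm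
  -- The integrand varies with `n`, so martingale convergence does not apply directly. Freezing it
  -- at `m` makes `h2` available, and the error of freezing is `ℱ n`-measurable, so it leaves the
  -- conditional expectation.
  have h3 : ∀ᵐ ω ∂M, ∀ m n, m ≤ n → (M[fun x => |g x - (M[g | ℱ n]) x| | ℱ n]) ω ≤
      (M[fun x => |g x - (M[g | ℱ m]) x| | ℱ n]) ω + |(M[g | ℱ m]) ω - (M[g | ℱ n]) ω| := by
    refine ae_all_iff.2 fun m => ae_all_iff.2 fun n => ?_
    by_cases hmn : m ≤ n
    swap
    · exact ae_of_all _ fun _ h => absurd h hmn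
    have hd : Integrable (fun x => |(M[g | ℱ m]) x - (M[g | ℱ n]) x|) M :=
      (integrable_condExp.sub integrable_condExp).abs
    have hdm : StronglyMeasurable[ℱ n] (fun x => ‖(M[g | ℱ m] - M[g | ℱ n]) x‖) :=
      (stronglyMeasurable_condExp.mono (ℱ.mono hmn) |>.sub stronglyMeasurable_condExp).norm
    have hmono := condExp_mono (m := ℱ n) (hsub n) ((hsub m).add hd)
      (ae_of_all _ fun x => by
        simpa using abs_sub_le (g x) ((M[g | ℱ m]) x) ((M[g | ℱ n]) x))
    filter_upwards [hmono, condExp_add (hsub m) hd (ℱ n)] with ω hω hadd _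
    rw [hadd, Pi.add_apply] at hω
    exact hω.trans_eq (congrArg _ (congrFun (condExp_of_stronglyMeasurable (ℱ.le n) hdm hd) ω))
  have h4 : ∀ᵐ ω ∂M, ∀ n, 0 ≤ (M[fun x => |g x - (M[g | ℱ n]) x| | ℱ n]) ω :=
    ae_all_iff.2 fun n => condExp_nonneg (ae_of_all _ fun x => abs_nonneg _)
  filter_upwards [h1, h2, h3, h4] with ω h1 h2 h3 h4
  rw [Metric.tendsto_atTop]
  intro ε hε
  -- Four errors are added: the limit in `h2`, its value at `m`, and the distances of the `m`-th and
  -- `n`-th conditional expectations from `g`.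
  obtain ⟨m, hm⟩ := Metric.tendsto_atTop.1 h1 (ε / 4) (by positivity)
  have hmm := hm m le_rfl
  rw [Real.dist_eq, abs_sub_comm] at hmm
  obtain ⟨k, hk⟩ := Metric.tendsto_atTop.1 (h2 m) (ε / 4) (by positivity)
  refine ⟨max m k, fun n hn => ?_⟩
  have hkn := hk n (le_of_max_le_right hn)
  have hmn := hm n (le_of_max_le_left hn)
  have := h3 m n (le_of_max_le_left hn)
  rw [Real.dist_eq] at hkn hmn
  rw [Real.dist_eq, sub_zero, abs_of_nonneg (h4 n)]
  have h5 := abs_sub_le ((M[g | ℱ m]) ω) (g ω) ((M[g | ℱ n]) ω)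
  rw [abs_sub_comm ((M[g | ℱ m]) ω) (g ω), abs_sub_comm (g ω) ((M[g | ℱ n]) ω)] at h5
  have := (abs_lt.1 hkn).2
  linarith

/-- If `g` is integrable and `f` is bounded by `C`, replacing `g` by its conditional expectation
in `M[g * f | m]` costs at most `C` times the conditional `L¹` error. -/
theorem abs_condExp_mul_sub_le {m m0 : MeasurableSpace Ω} (M : Measure Ω) [IsFiniteMeasure M]
    {g f : Ω → ℝ} (hg : Integrable g M) (hf : AEStronglyMeasurable f M)
    {C : ℝ} (hfC : ∀ ω, |f ω| ≤ C) :
    ∀ᵐ ω ∂M, |(M[g * f | m]) ω - (M[g | m]) ω * (M[f | m]) ω| ≤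
      C * (M[fun x => |g x - (M[g | m]) x| | m]) ω := by
  have hfi : Integrable f M := Integrable.of_bound hf C (ae_of_all _ hfC)
  have hgf : Integrable (g * f) M := hg.mul_bdd hf (ae_of_all _ hfC)
  have hGf : Integrable (M[g | m] * f) M := integrable_condExp.mul_bdd hf (ae_of_all _ hfC)
  have habs : Integrable (fun x => C * |g x - (M[g | m]) x|) M :=
    (hg.sub integrable_condExp).abs.const_mul C
  have hbound : ∀ x, |(g * f - M[g | m] * f) x| ≤ C * |g x - (M[g | m]) x| := fun x => by
    simp only [Pi.sub_apply, Pi.mul_apply]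
    rw [← sub_mul, abs_mul, mul_comm]
    exact mul_le_mul_of_nonneg_right (hfC x) (abs_nonneg _)
  have hup := condExp_mono (m := m) (hgf.sub hGf) habs
    (ae_of_all _ fun x => (abs_le.1 (hbound x)).2)
  have hlo := condExp_mono (m := m) habs.neg (hgf.sub hGf)
    (ae_of_all _ fun x => (abs_le.1 (hbound x)).1)
  have hC : M[fun x => C * |g x - (M[g | m]) x| | m] =ᵐ[M]
      C • M[fun x => |g x - (M[g | m]) x| | m] :=
    condExp_smul C (fun x => |g x - (M[g | m]) x|) m
  filter_upwards [hup, hlo, hC, condExp_neg (fun x => C * |g x - (M[g | m]) x|) m,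
    condExp_sub hgf hGf m,
    condExp_mul_of_stronglyMeasurable_left stronglyMeasurable_condExp hGf hfi]
    with ω hup hlo hC hneg hsub hpull
  have hneg' : (M[-fun x => C * |g x - (M[g | m]) x| | m]) ω = _ := hneg
  rw [hsub] at hup
  rw [hsub] at hlo
  replace hlo := hneg'.symm.trans_le hlo
  simp only [Pi.sub_apply, Pi.neg_apply, Pi.mul_apply, Pi.smul_apply, smul_eq_mul]
    at hup hlo hC hpull
  rw [hpull, hC] at hup hlo
  exact abs_le.2 ⟨hlo, hup⟩

/-- **Merging of opinions.** Let `p` and `q` be densities with respect to `M`, and let `u n`, `v n`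
be the conditional expectations given `ℱ n` of a bounded `f n` under `p • M` and `q • M`. Then
`u n - v n` tends to zero wherever both densities are nonzero. -/
theorem tendsto_sub_of_condExp_mul (M : Measure Ω) [IsFiniteMeasure M] (ℱ : Filtration ℕ m0)
    {p q : Ω → ℝ} (hp : Integrable p M) (hq : Integrable q M)
    (hpm : StronglyMeasurable[⨆ n, ℱ n] p) (hqm : StronglyMeasurable[⨆ n, ℱ n] q)
    {f : ℕ → Ω → ℝ} (hf : ∀ n, AEStronglyMeasurable (f n) M)
    {C : ℝ} (hfC : ∀ n ω, |f n ω| ≤ C) {u v : ℕ → Ω → ℝ}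
    (hu : ∀ᶠ n in atTop, M[p * f n | ℱ n] =ᵐ[M] M[p | ℱ n] * u n)
    (hv : ∀ᶠ n in atTop, M[q * f n | ℱ n] =ᵐ[M] M[q | ℱ n] * v n) :
    ∀ᵐ ω ∂M, p ω ≠ 0 → q ω ≠ 0 → Tendsto (fun n => u n ω - v n ω) atTop (𝓝 0) := by
  obtain ⟨N, hN⟩ := eventually_atTop.1 (hu.and hv)
  have hN' : ∀ᵐ ω ∂M, ∀ n, N ≤ n → (M[p * f n | ℱ n]) ω = (M[p | ℱ n]) ω * u n ω ∧
      (M[q * f n | ℱ n]) ω = (M[q | ℱ n]) ω * v n ω := by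
    refine ae_all_iff.2 fun n => ?_
    by_cases h : N ≤ n
    · filter_upwards [(hN n h).1, (hN n h).2] with ω h1 h2 _ using ⟨h1, h2⟩
    · exact ae_of_all _ fun _ h' => absurd h' h
  have hbp := ae_all_iff.2 fun n => abs_condExp_mul_sub_le (m := ℱ n) M hp (hf n) (hfC n)
  have hbq := ae_all_iff.2 fun n => abs_condExp_mul_sub_le (m := ℱ n) M hq (hf n) (hfC n)
  filter_upwards [hN', hbp, hbq, hp.tendsto_ae_condExp hpm, hq.tendsto_ae_condExp hqm,
    tendsto_condExp_abs_sub_condExp M ℱ hp hpm, tendsto_condExp_abs_sub_condExp M ℱ hq hqm]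
    with ω hN' hbp hbq hlp hlq hep heq hp0 hq0
  have hlim : Tendsto (fun n => (M[p | ℱ n]) ω * (M[q | ℱ n]) ω) atTop (𝓝 (p ω * q ω)) :=
    hlp.mul hlq
  have hne : p ω * q ω ≠ 0 := mul_ne_zero hp0 hq0
  have hbound : Tendsto (fun n =>
      |(M[q | ℱ n]) ω| * (C * (M[fun x => |p x - (M[p | ℱ n]) x| | ℱ n]) ω)
      + |(M[p | ℱ n]) ω| * (C * (M[fun x => |q x - (M[q | ℱ n]) x| | ℱ n]) ω)) atTop (𝓝 0) := by
    simpa using (hlq.abs.mul (hep.const_mul C)).add (hlp.abs.mul (heq.const_mul C))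
  have hprod : Tendsto (fun n => (M[p | ℱ n]) ω * (M[q | ℱ n]) ω * (u n ω - v n ω)) atTop
      (𝓝 0) := by
    refine squeeze_zero_norm' ?_ hbound
    filter_upwards [eventually_ge_atTop N] with n hn
    obtain ⟨h1, h2⟩ := hN' n hn
    have hbp := hbp n
    have hbq := hbq n
    rw [h1] at hbp
    rw [h2] at hbq
    -- The common comparison value `M[f n | ℱ n]` cancels. Multiplying by both conditional densities
    -- postpones division until they are known to be nonzero.
    have hsplit : (M[p | ℱ n]) ω * (M[q | ℱ n]) ω * (u n ω - v n ω) =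
        (M[q | ℱ n]) ω * ((M[p | ℱ n]) ω * u n ω - (M[p | ℱ n]) ω * (M[f n | ℱ n]) ω) -
        (M[p | ℱ n]) ω * ((M[q | ℱ n]) ω * v n ω - (M[q | ℱ n]) ω * (M[f n | ℱ n]) ω) := by
      ring
    rw [hsplit, Real.norm_eq_abs]
    refine (abs_sub _ _).trans (add_le_add ?_ ?_)
    · rw [abs_mul]
      exact mul_le_mul_of_nonneg_left hbp (abs_nonneg _)
    · rw [abs_mul]
      exact mul_le_mul_of_nonneg_left hbq (abs_nonneg _)
  have hquot := hprod.div hlim hne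
  rw [zero_div] at hquot
  refine hquot.congr' ?_
  filter_upwards [hlim.eventually_ne hne] with n hn
  exact mul_div_cancel_left₀ _ hn

end Merging

/-! ### Likelihood ratios: the dichotomy and the maximal inequality. -/

section LikelihoodRatio

variable {Ω : Type*} {m0 : MeasurableSpace Ω}

/-- If the laws of `X` under `P` and `M` have densities `a ≤ s` with respect to a common measure,
then the conditional expectation of `dP/dM` given `X` is the quotient of these densities. -/
theorem condExp_rnDeriv_comap_eq {H : Type*} [mH : MeasurableSpace H] {P M : Measure Ω}
    [IsFiniteMeasure P] [IsFiniteMeasure M] (hPM : P ≪ M) {X : Ω → H} (hX : Measurable X)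
    {R : Measure H} {a s : H → ℝ≥0∞} (ha : Measurable a) (hs : Measurable s) (has : a ≤ s)
    (hP : P.map X = R.withDensity a) (hM : M.map X = R.withDensity s) :
    (fun ω => (a (X ω) / s (X ω)).toReal) =ᵐ[M]
      M[fun ω => (P.rnDeriv M ω).toReal | mH.comap X] := by
  have hle : ∀ h, a h / s h ≤ 1 := fun h => ENNReal.div_le_of_le_mul (by simpa using has h)
  have hmeas : Measurable (fun h => a h / s h) := ha.div hs
  have hmeasX : Measurable (fun ω => a (X ω) / s (X ω)) := hmeas.comp hX
  have hsfin : ∀ᵐ h ∂(R), s h < ∞ := by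
    refine ae_lt_top hs ?_
    rw [← setLIntegral_univ, ← withDensity_apply _ MeasurableSet.univ, ← hM]
    exact measure_ne_top _ _
  have hXm : Measurable[mH.comap X] X := comap_measurable X
  refine ae_eq_condExp_of_forall_setIntegral_eq hX.comap_le Measure.integrable_toReal_rnDeriv
    (fun A _ _ => ?_) ?_ ?_
  · refine (Integrable.of_bound (C := 1) ?_ (ae_of_all _ fun ω => ?_)).integrableOn
    · exact (hmeas.comp hX).ennreal_toReal.aestronglyMeasurable
    · rw [Real.norm_of_nonneg ENNReal.toReal_nonneg]
      exact ENNReal.toReal_le_of_le_ofReal zero_le_one (by simpa using hle (X ω))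
  · rintro _ ⟨B, hB, rfl⟩ -
    rw [Measure.setIntegral_toReal_rnDeriv hPM,
      integral_toReal hmeasX.aemeasurable
        (ae_of_all _ fun ω => (hle (X ω)).trans_lt ENNReal.one_lt_top), Measure.real]
    congr 1
    rw [← setLIntegral_map hB hmeas hX, ← Measure.map_apply hX hB, hM, hP, withDensity_apply _ hB,
      setLIntegral_withDensity_eq_setLIntegral_mul _ hs hmeas hB]
    refine lintegral_congr_ae (ae_restrict_of_ae ?_)
    filter_upwards [hsfin] with h hh
    -- Where `s` vanishes so does `a`, and the convention `0 / 0 = 0` does no harm.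
    by_cases h0 : s h = 0
    · have : a h = 0 := le_antisymm ((has h).trans_eq h0) zero_le
      simp [h0, this]
    · exact ENNReal.mul_div_cancel h0 hh.ne
  · exact ((hmeas.comp hXm).ennreal_toReal.stronglyMeasurable).aestronglyMeasurable

/-- If `u` is the conditional expectation of `f` under `P`, then `M[dP/dM * f] = M[dP/dM] * u`. -/
theorem condExp_rnDeriv_mul_eq {m m0 : MeasurableSpace Ω} (hm : m ≤ m0) {P M : Measure Ω}
    [IsFiniteMeasure P] [IsFiniteMeasure M] (hPM : P ≪ M) {f u : Ω → ℝ} {C : ℝ}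
    (hf : AEStronglyMeasurable f M) (hfC : ∀ ω, |f ω| ≤ C)
    (hu : StronglyMeasurable[m] u) (huC : ∀ ω, |u ω| ≤ C)
    (hfu : ∀ A, MeasurableSet[m] A → ∫ ω in A, f ω ∂P = ∫ ω in A, u ω ∂P) :
    M[(fun ω => (P.rnDeriv M ω).toReal) * f | m] =ᵐ[M]
      M[fun ω => (P.rnDeriv M ω).toReal | m] * u := by
  have hp : Integrable (fun ω => (P.rnDeriv M ω).toReal) M := Measure.integrable_toReal_rnDeriv
  have hum : AEStronglyMeasurable u M := (hu.mono hm).aestronglyMeasurable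
  have hpf : Integrable ((fun ω => (P.rnDeriv M ω).toReal) * f) M :=
    hp.mul_bdd hf (ae_of_all _ hfC)
  have hpu : Integrable ((fun ω => (P.rnDeriv M ω).toReal) * u) M :=
    hp.mul_bdd hum (ae_of_all _ huC)
  -- With `u` pulled out, it remains to compare integrals over `A` in `m`: both sides reduce to
  -- integrals under `P`, which agree by `hfu`.
  refine EventuallyEq.trans ?_ (condExp_mul_of_stronglyMeasurable_right hu hpu hp)
  refine ae_eq_condExp_of_forall_setIntegral_eq hm hpu
    (fun _ _ _ => integrable_condExp.integrableOn) (fun A hA _ => ?_)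
    stronglyMeasurable_condExp.aestronglyMeasurable
  rw [setIntegral_condExp hm hpf hA]
  have h1 := setIntegral_rnDeriv_smul (f := f) hPM (hm A hA)
  have h2 := setIntegral_rnDeriv_smul (f := u) hPM (hm A hA)
  simp only [smul_eq_mul] at h1 h2
  exact h1.trans ((hfu A hA).trans h2.symm)

/-- Let `a n` and `b n` be densities of the laws of `X n` under `P` and `Q`. Then `P`-almost surely
either the conditional expectations of bounded quantities under `P` and `Q` merge, or the
likelihood ratio `b n / a n` tends to zero. -/
theorem merging_or_likelihoodRatio_tendsto_zero {H : ℕ → Type*} [mH : ∀ n, MeasurableSpace (H n)]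
    (P Q : Measure Ω) [IsFiniteMeasure P] [IsFiniteMeasure Q] (ℱ : Filtration ℕ m0)
    (hsup : m0 ≤ ⨆ n, ℱ n) {X : ∀ n, Ω → H n} (hX : ∀ n, Measurable (X n))
    (hℱ : ∀ n, ℱ n = (mH n).comap (X n)) {R : ∀ n, Measure (H n)} {a b : ∀ n, H n → ℝ≥0∞}
    (ha : ∀ n, Measurable (a n)) (hb : ∀ n, Measurable (b n))
    (hP : ∀ n, P.map (X n) = (R n).withDensity (a n))
    (hQ : ∀ n, Q.map (X n) = (R n).withDensity (b n))
    {f u v : ℕ → Ω → ℝ} {C : ℝ} (hf : ∀ n, Measurable (f n)) (hfC : ∀ n ω, |f n ω| ≤ C)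
    (hu : ∀ n, StronglyMeasurable[ℱ n] (u n)) (huC : ∀ n ω, |u n ω| ≤ C)
    (hv : ∀ n, StronglyMeasurable[ℱ n] (v n)) (hvC : ∀ n ω, |v n ω| ≤ C)
    (hfu : ∀ᶠ n in atTop, ∀ A, MeasurableSet[ℱ n] A → ∫ ω in A, f n ω ∂P = ∫ ω in A, u n ω ∂P)
    (hfv : ∀ᶠ n in atTop, ∀ A, MeasurableSet[ℱ n] A → ∫ ω in A, f n ω ∂Q = ∫ ω in A, v n ω ∂Q) :
    ∀ᵐ ω ∂P, Tendsto (fun n => u n ω - v n ω) atTop (𝓝 0) ∨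
      ∀ c : ℝ≥0∞, c ≠ 0 → c ≠ ∞ → ∀ᶠ n in atTop, b n (X n ω) < c * a n (X n ω) := by
  set M := P + Q with hMdef
  have hPM : P ≪ M := Measure.AbsolutelyContinuous.rfl.add_right Q
  have hQM : Q ≪ M := by
    rw [hMdef, add_comm]
    exact Measure.AbsolutelyContinuous.rfl.add_right P
  have hM : ∀ n, M.map (X n) = (R n).withDensity (fun h => a n h + b n h) := fun n => by
    rw [hMdef, Measure.map_add _ _ (hX n), hP, hQ]
    exact (withDensity_add_left (ha n) _).symm
  set p : Ω → ℝ := fun ω => (P.rnDeriv M ω).toReal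
  set q : Ω → ℝ := fun ω => (Q.rnDeriv M ω).toReal
  have hp : Integrable p M := Measure.integrable_toReal_rnDeriv
  have hq : Integrable q M := Measure.integrable_toReal_rnDeriv
  have hpm : StronglyMeasurable[⨆ n, ℱ n] p :=
    (Measure.measurable_rnDeriv P M).ennreal_toReal.stronglyMeasurable.mono hsup
  have hqm : StronglyMeasurable[⨆ n, ℱ n] q :=
    (Measure.measurable_rnDeriv Q M).ennreal_toReal.stronglyMeasurable.mono hsup
  have hmerge := tendsto_sub_of_condExp_mul M ℱ hp hq hpm hqm
    (fun n => (hf n).aestronglyMeasurable) hfC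
    (hfu.mono fun n h => condExp_rnDeriv_mul_eq (ℱ.le n) hPM (hf n).aestronglyMeasurable
      (hfC n) (hu n) (huC n) h)
    (hfv.mono fun n h => condExp_rnDeriv_mul_eq (ℱ.le n) hQM (hf n).aestronglyMeasurable
      (hfC n) (hv n) (hvC n) h)
  have hcp : ∀ᵐ ω ∂M, ∀ n,
      (a n (X n ω) / (a n (X n ω) + b n (X n ω))).toReal = (M[p | ℱ n]) ω := by
    refine ae_all_iff.2 fun n => ?_
    have h := condExp_rnDeriv_comap_eq hPM (hX n) (ha n) ((ha n).add (hb n))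
      (fun h => le_self_add) (hP n) (hM n)
    rw [← hℱ n] at h
    exact h
  have hcq : ∀ᵐ ω ∂M, ∀ n,
      (b n (X n ω) / (a n (X n ω) + b n (X n ω))).toReal = (M[q | ℱ n]) ω := by
    refine ae_all_iff.2 fun n => ?_
    have h := condExp_rnDeriv_comap_eq hQM (hX n) (hb n) ((ha n).add (hb n))
      (fun h => le_add_self) (hQ n) (hM n)
    rw [← hℱ n] at h
    exact h
  filter_upwards [hPM.ae_le hmerge, hPM.ae_le hcp, hPM.ae_le hcq,
    hPM.ae_le (hp.tendsto_ae_condExp hpm), hPM.ae_le (hq.tendsto_ae_condExp hqm),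
    Measure.rnDeriv_pos hPM, hPM.ae_le (Measure.rnDeriv_lt_top P M)]
    with ω hmerge hcp hcq hlp hlq hpos hlt
  have hp0 : 0 < p ω := ENNReal.toReal_pos hpos.ne' hlt.ne
  by_cases hq0 : q ω = 0
  swap
  · exact Or.inl (hmerge hp0.ne' hq0)
  refine Or.inr fun c hc0 hct => ?_
  have hc : 0 < c.toReal := ENNReal.toReal_pos hc0 hct
  rw [hq0] at hlq
  have hlim : ∀ᶠ n in atTop, (M[q | ℱ n]) ω < c.toReal * (M[p | ℱ n]) ω :=
    hlq.eventually_lt (hlp.const_mul c.toReal) (mul_pos hc hp0)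
  filter_upwards [hlim, hlp.eventually (lt_mem_nhds hp0)] with n hn hpn
  rw [← hcp, ← hcq, ENNReal.toReal_div, ENNReal.toReal_div, ← mul_div_assoc] at hn
  rw [← hcp, ENNReal.toReal_div] at hpn
  -- A zero here, whether from a vanishing or an infinite sum, would make the conditional density of
  -- `P` zero, although it is eventually positive.
  have hs : 0 < (a n (X n ω) + b n (X n ω)).toReal := by
    refine lt_of_le_of_ne ENNReal.toReal_nonneg fun h => ?_
    rw [← h, div_zero] at hpn
    exact lt_irrefl _ hpn
  have htop := (ENNReal.toReal_pos_iff.1 hs).2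
  have hab := ENNReal.add_lt_top.1 htop
  rw [div_lt_div_iff_of_pos_right hs, ← ENNReal.toReal_mul] at hn
  exact (ENNReal.toReal_lt_toReal hab.2.ne (ENNReal.mul_ne_top hct hab.1.ne)).1 hn

/-- A maximal inequality: if `P ≤ c • Q` on the `ℱ n`-measurable subsets of `A n` for each `n`, then
the probability that some `A n` occurs is at most `c * Q univ`. -/
theorem measure_iUnion_le_of_forall_subset_le (P Q : Measure Ω) (ℱ : Filtration ℕ m0)
    {A : ℕ → Set Ω} (hA : ∀ n, MeasurableSet[ℱ n] (A n)) (c : ℝ≥0∞)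
    (h : ∀ n B, MeasurableSet[ℱ n] B → B ⊆ A n → P B ≤ c * Q B) :
    P (⋃ n, A n) ≤ c * Q Set.univ := by
  -- `disjointed A n` is the event that `n` is the first time at which some `A n` occurs; it is
  -- decided at time `n`, so `h` applies to it.
  have hD : ∀ n, MeasurableSet[ℱ n] (disjointed A n) := fun n => by
    rw [disjointed_eq_inter_compl]
    refine MeasurableSet.inter (hA n) ?_
    exact MeasurableSet.iInter fun j => MeasurableSet.iInter fun hj =>
      (ℱ.mono hj.le _ (hA j)).compl
  have hD' : ∀ n, MeasurableSet (disjointed A n) := fun n => ℱ.le n _ (hD n)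
  calc P (⋃ n, A n) = P (⋃ n, disjointed A n) := by rw [iUnion_disjointed]
    _ ≤ ∑' n, P (disjointed A n) := measure_iUnion_le _
    _ ≤ ∑' n, c * Q (disjointed A n) :=
      ENNReal.tsum_le_tsum fun n => h n _ (hD n) (disjointed_le A n)
    _ = c * Q (⋃ n, disjointed A n) := by
      rw [ENNReal.tsum_mul_left, measure_iUnion (disjoint_disjointed A) hD']
    _ ≤ c * Q Set.univ := by gcongr; exact Set.subset_univ _

/-- Let `a n` and `b n` be densities of the laws of `X n` under `P` and `Q`. The `P`-probability
that ever `w * a n ≤ w' * b n` is at most `w' / w * Q univ`. -/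
theorem measure_exists_mul_density_le {H : ℕ → Type*} [mH : ∀ n, MeasurableSpace (H n)]
    (P Q : Measure Ω) (ℱ : Filtration ℕ m0) {X : ∀ n, Ω → H n} (hX : ∀ n, Measurable (X n))
    (hℱ : ∀ n, ℱ n = (mH n).comap (X n)) {R : ∀ n, Measure (H n)} {a b : ∀ n, H n → ℝ≥0∞}
    (ha : ∀ n, Measurable (a n)) (hb : ∀ n, Measurable (b n))
    (hP : ∀ n, P.map (X n) = (R n).withDensity (a n))
    (hQ : ∀ n, Q.map (X n) = (R n).withDensity (b n))
    {w w' : ℝ≥0∞} (hw0 : w ≠ 0) (hwt : w ≠ ∞) :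
    P {ω | ∃ n, w * a n (X n ω) ≤ w' * b n (X n ω)} ≤ w' / w * Q Set.univ := by
  have hS : ∀ n, MeasurableSet {h | w * a n h ≤ w' * b n h} := fun n =>
    measurableSet_le ((ha n).const_mul w) ((hb n).const_mul w')
  rw [Set.ofPred_exists]
  refine measure_iUnion_le_of_forall_subset_le P Q ℱ (fun n => ?_) _ fun n B hB hBA => ?_
  · rw [hℱ n]
    exact ⟨_, hS n, rfl⟩
  · rw [hℱ n] at hB
    obtain ⟨B, hB, rfl⟩ := hB
    have hle : w * P (X n ⁻¹' B) ≤ w' * Q (X n ⁻¹' B) := by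
      have hB' : MeasurableSet (B ∩ {h | w * a n h ≤ w' * b n h}) := hB.inter (hS n)
      have hpre : X n ⁻¹' B = X n ⁻¹' (B ∩ {h | w * a n h ≤ w' * b n h}) := by
        rw [Set.preimage_inter]
        exact (Set.inter_eq_left.2 hBA).symm
      rw [hpre, ← Measure.map_apply (hX n) hB', ← Measure.map_apply (hX n) hB', hP, hQ,
        withDensity_apply _ hB', withDensity_apply _ hB', ← lintegral_const_mul _ (ha n),
        ← lintegral_const_mul _ (hb n)]
      exact setLIntegral_mono' hB' fun h hh => hh.2
    rw [ENNReal.mul_comm_div, mul_div_assoc', ENNReal.le_div_iff_mul_le (Or.inl hw0) (Or.inl hwt),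
      mul_comm]
    exact hle

end LikelihoodRatio

/-! ### Histories, likelihood products and discounted rewards. -/

section Cycles

variable {Y O : Type*}

/-- Appending one cycle to a history. -/
def appendCycle (t : ℕ) (a : (History Y O t × Y) × Percept O) : History Y O (t + 1) :=
  Fin.snoc (α := fun _ => InteractionCycle Y O) a.1.1 (a.1.2, a.2)

theorem appendCycle_firstCycles (t : ℕ) (ω : Trajectory Y O) :
    appendCycle t ((firstCycles ω t, (ω t).1), (ω t).2) = firstCycles ω (t + 1) := by
  funext i
  refine Fin.lastCases ?_ (fun j => ?_) i
  · simp [appendCycle, firstCycles]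
  · simp [appendCycle, firstCycles]

/-- Earlier factors see only the old history, and the new cycle contributes the last factor. This
recursion carries the induction that identifies the likelihood. -/
theorem condDensity_appendCycle {q : ∀ t : ℕ, (History Y O t × Y) × Percept O → ℝ≥0∞}
    (t : ℕ) (a : (History Y O t × Y) × Percept O) :
    condDensity q (t + 1) (appendCycle t a) = condDensity q t a.1.1 * q t a := by
  rw [condDensity, Fin.prod_univ_castSucc, condDensity]
  congr 1
  · refine Finset.prod_congr rfl fun i _ => ?_
    have hpast : (fun s : Fin i => appendCycle t a (Fin.castLE i.castSucc.isLt.le s)) =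
        fun s : Fin i => a.1.1 (Fin.castLE i.isLt.le s) := by
      funext s
      exact Fin.snoc_castSucc (α := fun _ => InteractionCycle Y O) _ _
        (Fin.castLE i.isLt.le s)
    have hnow : appendCycle t a i.castSucc = a.1.1 i :=
      Fin.snoc_castSucc (α := fun _ => InteractionCycle Y O) _ _ _
    rw [hnow]
    exact congrArg (fun h => q i ((h, (a.1.1 i).1), (a.1.1 i).2)) hpast
  · have hpast : (fun s : Fin t => appendCycle t a (Fin.castLE (Fin.last t).isLt.le s)) =
        a.1.1 := by
      funext s
      exact Fin.snoc_castSucc (α := fun _ => InteractionCycle Y O) _ _ s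
    have hnow : appendCycle t a (Fin.last t) = (a.1.2, a.2) :=
      Fin.snoc_last (α := fun _ => InteractionCycle Y O) _ _
    rw [hnow]
    exact congrArg (fun h => q t ((h, a.1.2), a.2)) hpast

/-- The discounted sum of the rewards received after the first `ℓ` cycles. -/
noncomputable def discountedReward (γ : ℝ) (ℓ : ℕ) (ω : Trajectory Y O) : ℝ :=
  ∑' k : ℕ, γ ^ k * ((ω (ℓ + k)).2.2 : ℝ)

theorem abs_discountedReward_le {γ : ℝ} (hγ0 : 0 ≤ γ) (hγ1 : γ < 1) (ℓ : ℕ) (ω : Trajectory Y O) :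
    |discountedReward γ ℓ ω| ≤ (1 - γ)⁻¹ := by
  rw [← Real.norm_eq_abs]
  refine tsum_of_norm_bounded (hasSum_geometric_of_lt_one hγ0 hγ1) fun k => ?_
  have h := (ω (ℓ + k)).2.2.2
  rw [Real.norm_of_nonneg (mul_nonneg (pow_nonneg hγ0 k) h.1)]
  exact mul_le_of_le_one_right (pow_nonneg hγ0 k) h.2

end Cycles

/-! ### The interaction law and its conditional laws. -/

section InteractionLaw

variable {Y O : Type*} [MeasurableSpace Y] [MeasurableSpace O]

theorem measurable_firstCycles (t : ℕ) :
    Measurable (fun ω : Trajectory Y O => firstCycles ω t) :=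
  measurable_pi_lambda _ fun _ => measurable_pi_apply _

theorem interactionLaw_eq_trajMeasure (π : Policy Y O) (ν : Environment Y O) :
    interactionLaw π ν = Kernel.trajMeasure (X := fun _ => InteractionCycle Y O)
      (cycleKernel π ν 0 Fin.elim0) (stepKernel π ν) := by
  rw [interactionLaw, predictive, Kernel.trajMeasure, Kernel.comp_apply,
    Kernel.map_apply (f := fun (c : InteractionCycle Y O) (_ : Finset.Iic 0) => c) _
      (measurable_pi_lambda _ fun _ => measurable_id)]
  rfl

instance (π : Policy Y O) (ν : Environment Y O) : IsProbabilityMeasure (interactionLaw π ν) := by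
  rw [interactionLaw_eq_trajMeasure]
  infer_instance

instance (π : Policy Y O) (ν : Environment Y O) (ℓ : ℕ) : IsMarkovKernel (predictive π ν ℓ) := by
  cases ℓ with
  | zero =>
    rw [predictive]
    have : IsMarkovKernel ((cycleKernel π ν 0).map
        (fun (c : InteractionCycle Y O) (_ : Finset.Iic 0) => c)) :=
      Kernel.IsMarkovKernel.map _ (measurable_pi_lambda _ fun _ => measurable_id)
    infer_instance
  | succ n =>
    rw [predictive]
    infer_instance

/-- The trajectory measure disintegrates over its first coordinates, with the kernels `traj` as
conditional laws. -/
theorem map_frestrictLe_trajMeasure_compProd_traj {X : ℕ → Type*} [∀ n, MeasurableSpace (X n)]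
    {μ₀ : Measure (X 0)} [IsProbabilityMeasure μ₀]
    {κ : (n : ℕ) → Kernel ((i : Finset.Iic n) → X i) (X (n + 1))} [∀ n, IsMarkovKernel (κ n)]
    (b : ℕ) :
    (Kernel.trajMeasure μ₀ κ).map (Preorder.frestrictLe b) ⊗ₘ Kernel.traj κ b =
      (Kernel.trajMeasure μ₀ κ).map (fun x => (Preorder.frestrictLe b x, x)) := by
  rw [Measure.compProd_eq_comp_prod, Kernel.trajMeasure, Measure.map_comp _ _ (by fun_prop),
    Kernel.traj_map_frestrictLe, Measure.comp_assoc, Measure.map_comp _ _ (by fun_prop)]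
  congr with x₀ : 1
  rw [Kernel.comp_apply, ← Measure.compProd_eq_comp_prod, Kernel.map_apply _ (by fun_prop),
    Kernel.partialTraj_compProd_traj zero_le]

/-- The predictive distribution is the conditional law of the interaction given its past. -/
theorem map_firstCycles_compProd_predictive (π : Policy Y O) (ν : Environment Y O) (n : ℕ) :
    (interactionLaw π ν).map (fun ω => firstCycles ω (n + 1)) ⊗ₘ predictive π ν (n + 1) =
      (interactionLaw π ν).map (fun ω => (firstCycles ω (n + 1), ω)) := by
  have h := map_frestrictLe_trajMeasure_compProd_traj (X := fun _ => InteractionCycle Y O)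
    (μ₀ := cycleKernel π ν 0 Fin.elim0) (κ := stepKernel π ν) n
  rw [← interactionLaw_eq_trajMeasure] at h
  have hfc : (fun ω : Trajectory Y O => firstCycles ω (n + 1)) =
      toHistory n ∘ Preorder.frestrictLe n := rfl
  have hfr : Measurable (Preorder.frestrictLe (π := fun _ => InteractionCycle Y O) n) := by
    fun_prop
  have hmT := measurable_toHistory (Y := Y) (O := O) n
  have hpair : (fun ω : Trajectory Y O => (firstCycles ω (n + 1), ω)) =
      Prod.map (toHistory n) id ∘ fun ω => (Preorder.frestrictLe n ω, ω) := rfl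
  have hfr₂ : Measurable (fun ω : Trajectory Y O => (Preorder.frestrictLe n ω, ω)) :=
    hfr.prodMk measurable_id
  rw [hpair, ← Measure.map_map (hmT.prodMap measurable_id) hfr₂, ← h, hfc,
    ← Measure.map_map hmT hfr]
  ext s hs
  have hs' : MeasurableSet (Prod.map (toHistory n) id ⁻¹' s) :=
    (hmT.prodMap measurable_id) hs
  rw [Measure.compProd_apply hs, Measure.map_apply (hmT.prodMap measurable_id) hs,
    Measure.compProd_apply hs',
    lintegral_map (Kernel.measurable_kernel_prodMk_left hs) hmT]
  rfl

/-- The next cycle is drawn from the cycle kernel. -/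
theorem map_firstCycles_compProd_cycleKernel (π : Policy Y O) (ν : Environment Y O) (t : ℕ) :
    (interactionLaw π ν).map (fun ω => firstCycles ω t) ⊗ₘ cycleKernel π ν t =
      (interactionLaw π ν).map (fun ω => (firstCycles ω t, ω t)) := by
  cases t with
  | zero =>
    -- There is only one empty history, so its law is a Dirac mass and only the law of cycle `0` has
    -- to be identified.
    have h0 : (fun ω : Trajectory Y O => firstCycles ω 0) = fun _ => Fin.elim0 :=
      funext fun _ => Subsingleton.elim _ _
    have hev : (fun ω : Trajectory Y O => (firstCycles ω 0, ω 0)) =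
        (fun c : InteractionCycle Y O => ((Fin.elim0 : History Y O 0), c)) ∘ fun ω => ω 0 :=
      funext fun _ => Prod.ext (Subsingleton.elim _ _) rfl
    have hlaw : (interactionLaw π ν).map (fun ω => ω 0) = cycleKernel π ν 0 Fin.elim0 := by
      have hm : Measurable (fun (c : InteractionCycle Y O) (_ : Finset.Iic 0) => c) :=
        measurable_pi_lambda _ fun _ => measurable_id
      have he : Measurable
          (fun x : (i : Finset.Iic 0) → InteractionCycle Y O => x ⟨0, by simp⟩) :=
        measurable_pi_apply _
      have hcomp : (fun ω : Trajectory Y O => ω 0) =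
          (fun x : (i : Finset.Iic 0) → InteractionCycle Y O => x ⟨0, by simp⟩) ∘
            Preorder.frestrictLe 0 := rfl
      rw [hcomp, ← Measure.map_map he (by fun_prop), interactionLaw, predictive,
        ← Kernel.map_apply _ (by fun_prop), Kernel.map_comp, Kernel.traj_map_frestrictLe,
        Kernel.partialTraj_self, Kernel.id_comp, Kernel.map_apply _ hm, Measure.map_map he hm]
      exact Measure.map_id
    have hm : Measurable (fun c : InteractionCycle Y O => ((Fin.elim0 : History Y O 0), c)) :=
      measurable_const.prodMk measurable_id
    have he : Measurable (fun ω : Trajectory Y O => ω 0) := measurable_pi_apply 0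
    rw [hev, ← Measure.map_map hm he, hlaw, h0, Measure.map_const,
      measure_univ, one_smul]
    ext s hs
    rw [Measure.compProd_apply hs, lintegral_dirac' _ (Kernel.measurable_kernel_prodMk_left hs),
      Measure.map_apply hm hs]
  | succ n =>
    have hm : Measurable (Prod.map id (fun ω : Trajectory Y O => ω (n + 1)) :
        History Y O (n + 1) × Trajectory Y O → _) :=
      measurable_id.prodMap (measurable_pi_apply _)
    have hp : Measurable (fun ω : Trajectory Y O => (firstCycles ω (n + 1), ω)) :=
      (measurable_firstCycles _).prodMk measurable_id
    have hpair : (fun ω : Trajectory Y O => (firstCycles ω (n + 1), ω (n + 1))) =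
        Prod.map id (fun ω : Trajectory Y O => ω (n + 1)) ∘
          fun ω => (firstCycles ω (n + 1), ω) := rfl
    have hker : cycleKernel π ν (n + 1) =
        (predictive π ν (n + 1)).map (fun ω => ω (n + 1)) := by
      have h := Kernel.map_traj_succ_self (X := fun _ => InteractionCycle Y O)
        (κ := stepKernel π ν) (a := n)
      ext1 x
      rw [predictive, Kernel.map_apply _ (measurable_pi_apply _), Kernel.comap_apply,
        ← Kernel.map_apply _ (measurable_pi_apply _), h]
      rfl
    rw [hpair, ← Measure.map_map hm hp,
      ← map_firstCycles_compProd_predictive, hker,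
      Measure.compProd_map (measurable_pi_apply _)]

theorem measurable_appendCycle (t : ℕ) : Measurable (appendCycle (Y := Y) (O := O) t) := by
  refine measurable_pi_lambda _ fun i => ?_
  refine Fin.lastCases ?_ (fun j => ?_) i
  · simp only [appendCycle, Fin.snoc_last]
    fun_prop
  · simp only [appendCycle, Fin.snoc_castSucc]
    fun_prop

/-- Reassociating history, action and perception puts the environment last, where `IsEnvDensity`
applies. -/
theorem map_firstCycles_succ (π : Policy Y O) (ν : Environment Y O) (t : ℕ) :
    (interactionLaw π ν).map (fun ω => firstCycles ω (t + 1)) =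
      (pastActionLaw π ν t ⊗ₘ ν.perceive t).map (appendCycle t) := by
  have hfc : (fun ω : Trajectory Y O => firstCycles ω (t + 1)) =
      (appendCycle t ∘ MeasurableEquiv.prodAssoc.symm) ∘ fun ω => (firstCycles ω t, ω t) :=
    funext fun ω => (appendCycle_firstCycles t ω).symm
  rw [hfc, ← Measure.map_map ((measurable_appendCycle t).comp (MeasurableEquiv.measurable _))
      ((measurable_firstCycles t).prodMk (measurable_pi_apply t)),
    ← map_firstCycles_compProd_cycleKernel,
    ← Measure.map_map (measurable_appendCycle t) (MeasurableEquiv.measurable _), cycleKernel,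
    Measure.compProd_assoc, pastActionLaw]

/-! ### The likelihood as a density of the law of the history. -/

section Density

variable {q : ∀ t : ℕ, (History Y O t × Y) × Percept O → ℝ≥0∞}

theorem measurable_condDensity (hq : ∀ t, Measurable (q t)) (ℓ : ℕ) :
    Measurable (condDensity q ℓ) := by
  refine Finset.measurable_prod _ fun t _ => (hq t).comp ?_
  refine Measurable.prodMk (Measurable.prodMk ?_ (by fun_prop)) (by fun_prop)
  exact measurable_pi_lambda _ fun _ => measurable_pi_apply _

/-- A density in the past commutes with drawing the next variable. Thus the likelihood passes the
policy's action without acquiring a factor. -/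
theorem withDensity_compProd_left {α β : Type*} [MeasurableSpace α] [MeasurableSpace β]
    (μ : Measure α) [SFinite μ] (κ : Kernel α β) [IsSFiniteKernel κ] {f : α → ℝ≥0∞}
    (hf : Measurable f) :
    μ.withDensity f ⊗ₘ κ = (μ ⊗ₘ κ).withDensity (fun x => f x.1) := by
  ext s hs
  have hf' : Measurable (fun x : α × β => f x.1) := hf.comp measurable_fst
  rw [Measure.compProd_apply hs, withDensity_apply _ hs, ← lintegral_indicator hs,
    Measure.lintegral_compProd (hf'.indicator hs),
    lintegral_withDensity_eq_lintegral_mul _ hf (Kernel.measurable_kernel_prodMk_left hs)]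
  refine lintegral_congr fun a => ?_
  have hsa : MeasurableSet (Prod.mk a ⁻¹' s) := measurable_prodMk_left hs
  rw [Pi.mul_apply, ← setLIntegral_const, ← lintegral_indicator hsa]
  rfl

theorem map_withDensity_comp {α β : Type*} [MeasurableSpace α] [MeasurableSpace β]
    (μ : Measure α) {g : α → β} (hg : Measurable g) {f : β → ℝ≥0∞} (hf : Measurable f) :
    (μ.withDensity (fun x => f (g x))).map g = (μ.map g).withDensity f := by
  ext s hs
  rw [Measure.map_apply hg hs, withDensity_apply _ (hg hs), withDensity_apply _ hs,
    setLIntegral_map hs hf hg]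

/-- The "law" of the first cycles when the perceptions follow the reference kernels. -/
noncomputable def referenceLaw (π : Policy Y O)
    (ref : ∀ t : ℕ, Kernel (History Y O t × Y) (Percept O)) :
    ∀ ℓ : ℕ, Measure (History Y O ℓ)
  | 0 => Measure.dirac Fin.elim0
  | t + 1 => ((referenceLaw π ref t ⊗ₘ π.act t) ⊗ₘ ref t).map (appendCycle t)

variable {π : Policy Y O} {ν : Environment Y O}
  {ref : ∀ t : ℕ, Kernel (History Y O t × Y) (Percept O)}

instance (ℓ : ℕ) : SFinite (referenceLaw π ref ℓ) := by
  cases ℓ <;> (rw [referenceLaw]; infer_instance)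

/-- `Q(x|y)` is the density of the law of the first cycles with respect to the interaction of the
policy with the reference kernels. -/
theorem map_firstCycles_eq_withDensity [∀ t, IsSFiniteKernel (ref t)]
    (hq : IsEnvDensity π ν ref q) (ℓ : ℕ) :
    (interactionLaw π ν).map (fun ω => firstCycles ω ℓ) =
      (referenceLaw π ref ℓ).withDensity (condDensity q ℓ) := by
  induction ℓ with
  | zero =>
    have h0 : (fun ω : Trajectory Y O => firstCycles ω 0) = fun _ => Fin.elim0 :=
      funext fun _ => Subsingleton.elim _ _
    have h1 : condDensity q 0 = 1 := funext fun _ => by simp [condDensity]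
    rw [h0, h1, Measure.map_const, measure_univ, one_smul, withDensity_one, referenceLaw]
  | succ t ih =>
    have hD := measurable_condDensity hq.measurable t
    have hD₁ : Measurable (fun x : History Y O t × Y => condDensity q t x.1) :=
      hD.comp measurable_fst
    have hD₂ : Measurable (fun x : (History Y O t × Y) × Percept O => condDensity q t x.1.1) :=
      hD₁.comp measurable_fst
    rw [map_firstCycles_succ, hq.density, pastActionLaw, ih, withDensity_compProd_left _ _ hD,
      withDensity_compProd_left _ _ hD₁,
      ← withDensity_mul _ hD₂ (hq.measurable t),
      referenceLaw, ← map_withDensity_comp _ (measurable_appendCycle t)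
        (measurable_condDensity hq.measurable (t + 1))]
    simp only [condDensity_appendCycle]
    rfl

end Density

/-- The natural filtration of the interaction: `t` cycles are known at time `t`. -/
def cycleFiltration (Y O : Type*) [MeasurableSpace Y] [MeasurableSpace O] :
    Filtration ℕ (inferInstance : MeasurableSpace (Trajectory Y O)) where
  seq t := MeasurableSpace.comap (fun ω => firstCycles ω t) inferInstance
  mono' s t hst := by
    rintro _ ⟨B, hB, rfl⟩
    refine ⟨(fun h : History Y O t => fun i : Fin s => h (Fin.castLE hst i)) ⁻¹' B, ?_, rfl⟩
    exact (measurable_pi_lambda _ fun _ => measurable_pi_apply _) hB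
  le' t := (measurable_firstCycles t).comap_le

theorem le_iSup_cycleFiltration :
    (inferInstance : MeasurableSpace (Trajectory Y O)) ≤ ⨆ t, cycleFiltration Y O t := by
  -- Coordinate `i` is the last of the first `i + 1` cycles.
  refine iSup_le fun i => le_trans ?_ (le_iSup _ (i + 1))
  rintro _ ⟨B, hB, rfl⟩
  exact ⟨(fun h : History Y O (i + 1) => h (Fin.last i)) ⁻¹' B, measurable_pi_apply _ hB, rfl⟩

/-! ### The value as a conditional expectation. -/

section Value

variable {γ : ℝ}

theorem measurable_discountedReward (γ : ℝ) (ℓ : ℕ) :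
    Measurable (discountedReward (Y := Y) (O := O) γ ℓ) := by
  unfold discountedReward
  fun_prop

theorem abs_value_le (hγ0 : 0 ≤ γ) (hγ1 : γ < 1) (π : Policy Y O) (ν : Environment Y O) (ℓ : ℕ)
    (h : History Y O ℓ) : |value γ π ν ℓ h| ≤ (1 - γ)⁻¹ := by
  have := norm_integral_le_of_norm_le_const (f := discountedReward γ ℓ) (μ := predictive π ν ℓ h)
    (ae_of_all _ (abs_discountedReward_le hγ0 hγ1 ℓ))
  rw [probReal_univ, mul_one] at this
  exact this

theorem measurable_value (γ : ℝ) (π : Policy Y O) (ν : Environment Y O) (ℓ : ℕ) :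
    Measurable (value γ π ν ℓ) :=
  ((measurable_discountedReward γ ℓ).stronglyMeasurable.integral_kernel
    (κ := predictive π ν ℓ)).measurable

/-- The value is the conditional expectation of the discounted future rewards. -/
theorem setIntegral_discountedReward (hγ0 : 0 ≤ γ) (hγ1 : γ < 1) (π : Policy Y O)
    (ν : Environment Y O) (n : ℕ) {A : Set (Trajectory Y O)}
    (hA : MeasurableSet[cycleFiltration Y O (n + 1)] A) :
    ∫ ω in A, discountedReward γ (n + 1) ω ∂(interactionLaw π ν) =
      ∫ ω in A, value γ π ν (n + 1) (firstCycles ω (n + 1)) ∂(interactionLaw π ν) := by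
  obtain ⟨B, hB, rfl⟩ := hA
  have hfc := measurable_firstCycles (Y := Y) (O := O) (n + 1)
  have hr := measurable_discountedReward (Y := Y) (O := O) γ (n + 1)
  have hpair : Measurable (fun ω : Trajectory Y O => (firstCycles ω (n + 1), ω)) :=
    hfc.prodMk measurable_id
  have hr₂ : Measurable (fun x : History Y O (n + 1) × Trajectory Y O =>
      discountedReward γ (n + 1) x.2) := hr.comp measurable_snd
  have hint : Integrable (fun x : History Y O (n + 1) × Trajectory Y O =>
      discountedReward γ (n + 1) x.2) ((interactionLaw π ν).map
        (fun ω => firstCycles ω (n + 1)) ⊗ₘ predictive π ν (n + 1)) := by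
    rw [map_firstCycles_compProd_predictive]
    have : IsProbabilityMeasure ((interactionLaw π ν).map
        (fun ω => (firstCycles ω (n + 1), ω))) :=
      Measure.isProbabilityMeasure_map hpair.aemeasurable
    exact Integrable.of_bound hr₂.aestronglyMeasurable _
      (ae_of_all _ fun x => abs_discountedReward_le hγ0 hγ1 (n + 1) x.2)
  have hv : Measurable fun h : History Y O (n + 1) => ∫ ω in Set.univ,
      discountedReward γ (n + 1) ω ∂(predictive π ν (n + 1) h) := by
    simp_rw [Measure.restrict_univ]
    exact measurable_value γ π ν (n + 1)
  have h := Measure.setIntegral_compProd (s := B) (t := Set.univ) hB MeasurableSet.univ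
    hint.integrableOn
  rw [map_firstCycles_compProd_predictive, setIntegral_map (hB.prod MeasurableSet.univ)
    hr₂.aestronglyMeasurable hpair.aemeasurable, setIntegral_map hB
    hv.aestronglyMeasurable
    hfc.aemeasurable] at h
  simp only [Set.mk_preimage_prod, Set.preimage_univ, Set.inter_univ, Measure.restrict_univ] at h
  exact h

end Value

end InteractionLaw

/-! ### Codelengths as weighted likelihoods. -/

section MDL

/-- The prior weight `2^(-K)` of an environment of complexity `K`. -/
noncomputable def complexityWeight (K : ℝ) : ℝ≥0∞ := ENNReal.ofReal (2 ^ (-K))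

theorem complexityWeight_ne_zero (K : ℝ) : complexityWeight K ≠ 0 := by
  simpa [complexityWeight] using Real.rpow_pos_of_pos two_pos (-K)

theorem complexityWeight_ne_top (K : ℝ) : complexityWeight K ≠ ∞ := ENNReal.ofReal_ne_top

variable {Y O : Type*}

/-- The complexity is the negative binary logarithm of the weight. As it is finite, no `∞ - ∞`
arises, even when the likelihood is zero or infinite. -/
theorem codelength_eq (q : ∀ t : ℕ, (History Y O t × Y) × Percept O → ℝ≥0∞) (K : ℝ) (ℓ : ℕ)
    (h : History Y O ℓ) :
    codelength q K ℓ h =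
      -(ENNReal.log (complexityWeight K * condDensity q ℓ h) / ((Real.log 2 : ℝ) : EReal)) := by
  have hlog : 0 < Real.log 2 := Real.log_pos one_lt_two
  have hK : ENNReal.log (complexityWeight K) / ((Real.log 2 : ℝ) : EReal) = ((-K : ℝ) : EReal) := by
    rw [complexityWeight, ENNReal.log_ofReal_of_pos (Real.rpow_pos_of_pos two_pos _),
      Real.log_rpow two_pos, ← EReal.coe_div, mul_div_cancel_right₀ _ hlog.ne']
  rw [codelength, ENNReal.log_mul_add,
    EReal.add_div_of_nonneg_right (EReal.coe_nonneg.2 hlog.le), hK,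
    EReal.neg_add (Or.inl (EReal.coe_ne_bot _)) (Or.inl (EReal.coe_ne_top _)), EReal.coe_neg,
    neg_neg, sub_eq_add_neg, add_comm]

theorem codelength_le_codelength_iff (q q' : ∀ t : ℕ, (History Y O t × Y) × Percept O → ℝ≥0∞)
    (K K' : ℝ) (ℓ : ℕ) (h : History Y O ℓ) :
    codelength q K ℓ h ≤ codelength q' K' ℓ h ↔
      complexityWeight K' * condDensity q' ℓ h ≤ complexityWeight K * condDensity q ℓ h := by
  rw [codelength_eq, codelength_eq, EReal.neg_le_neg_iff,
    (EReal.strictMono_div_right_of_pos (EReal.coe_pos.2 (Real.log_pos one_lt_two))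
      (EReal.coe_ne_top _)).le_iff_le, ENNReal.log_le_log_iff]

/-- Anything outside `S` is worse than `i₀`, which lies in `S`; hence a best element of the finite
`S` is best overall. -/
theorem exists_isMDL_of_finite {ι : Type*}
    {q : ι → ∀ t : ℕ, (History Y O t × Y) × Percept O → ℝ≥0∞}
    {K : ι → ℝ} {ℓ : ℕ} {h : History Y O ℓ} (i₀ : ι) {S : Set ι} (hS : S.Finite)
    (hSi : ∀ i, complexityWeight (K i₀) * condDensity (q i₀) ℓ h ≤
      complexityWeight (K i) * condDensity (q i) ℓ h → i ∈ S) :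
    ∃ i, IsMDL q K ℓ h i := by
  obtain ⟨i, -, hi⟩ := hS.exists_maximalFor
    (fun i => complexityWeight (K i) * condDensity (q i) ℓ h) S ⟨i₀, hSi i₀ le_rfl⟩
  have hmax : ∀ j ∈ S, complexityWeight (K j) * condDensity (q j) ℓ h ≤
      complexityWeight (K i) * condDensity (q i) ℓ h := fun j hj =>
    (le_total _ _).elim id fun h => hi hj h
  refine ⟨i, fun j => (codelength_le_codelength_iff _ _ _ _ _ _).2 ?_⟩
  by_cases hj : j ∈ S
  · exact hmax j hj
  · exact (le_of_not_ge fun h => hj (hSi j h)).trans (hmax i₀ (hSi i₀ le_rfl))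

end MDL

/-! ### Convergence of the values selected by MDL. -/

theorem corollary6 {Y O ι : Type*} [MeasurableSpace Y] [MeasurableSpace O] [Countable ι]
    (π : Policy Y O) (ν : ι → Environment Y O) (i₀ : ι)
    (K : ι → ℝ) (hK : Summable fun i => (2 : ℝ) ^ (-(K i)))
    (ref : ∀ t : ℕ, Kernel (History Y O t × Y) (Percept O)) [∀ t, IsSFiniteKernel (ref t)]
    (q : ι → ∀ t : ℕ, (History Y O t × Y) × Percept O → ℝ≥0∞)
    (hq : ∀ i, IsEnvDensity π (ν i) ref (q i))
    (γ : ℝ) (hγ0 : 0 ≤ γ) (hγ1 : γ < 1) :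
    ∀ᵐ ω ∂(interactionLaw π (ν i₀)),
      (∀ ℓ, ∃ i, IsMDL q K ℓ (firstCycles ω ℓ) i) ∧
      ∀ mdl : ℕ → ι, (∀ ℓ, IsMDL q K ℓ (firstCycles ω ℓ) (mdl ℓ)) →
        Tendsto
          (fun ℓ => value γ π (ν (mdl ℓ)) ℓ (firstCycles ω ℓ)
            - value γ π (ν i₀) ℓ (firstCycles ω ℓ))
          atTop (𝓝 0) := by
  have hD : ∀ i ℓ, Measurable (condDensity (q i) ℓ) := fun i =>
    measurable_condDensity (hq i).measurable
  have hlaw := fun i => map_firstCycles_eq_withDensity (hq i)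
  have hℱ : ∀ n, cycleFiltration Y O n =
      MeasurableSpace.comap (fun ω : Trajectory Y O => firstCycles ω n) inferInstance :=
    fun _ => rfl
  have hval : ∀ i n, StronglyMeasurable[cycleFiltration Y O n]
      fun ω : Trajectory Y O => value γ π (ν i) n (firstCycles ω n) := fun i n =>
    ((measurable_value γ π (ν i) n).comp (comap_measurable _)).stronglyMeasurable
  have hdisc : ∀ i, ∀ᶠ n in atTop, ∀ A, MeasurableSet[cycleFiltration Y O n] A →
      ∫ ω in A, discountedReward γ n ω ∂(interactionLaw π (ν i)) =
        ∫ ω in A, value γ π (ν i) n (firstCycles ω n) ∂(interactionLaw π (ν i)) := fun i => by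
    -- `setIntegral_discountedReward` covers positive lengths only; the limit does not see length
    -- `0`.
    filter_upwards [eventually_ge_atTop 1] with n hn A hA
    obtain ⟨n, rfl⟩ := Nat.exists_eq_add_of_le' hn
    exact setIntegral_discountedReward hγ0 hγ1 π (ν i) n hA
  have hmerge := ae_all_iff.2 fun i => merging_or_likelihoodRatio_tendsto_zero
    (interactionLaw π (ν i₀)) (interactionLaw π (ν i)) (cycleFiltration Y O)
    le_iSup_cycleFiltration measurable_firstCycles hℱ (hD i₀) (hD i) (hlaw i₀) (hlaw i)
    (measurable_discountedReward γ) (abs_discountedReward_le hγ0 hγ1)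
    (hval i₀) (fun n ω => abs_value_le hγ0 hγ1 π (ν i₀) n _)
    (hval i) (fun n ω => abs_value_le hγ0 hγ1 π (ν i) n _) (hdisc i₀) (hdisc i)
  -- Borel–Cantelli over the competitors, not over time: the maximal inequality has already absorbed
  -- all `n`.
  have hsum : ∑' i, interactionLaw π (ν i₀) {ω | ∃ n,
      complexityWeight (K i₀) * condDensity (q i₀) n (firstCycles ω n) ≤
        complexityWeight (K i) * condDensity (q i) n (firstCycles ω n)} ≠ ∞ := by
    refine ne_top_of_le_ne_top (b := ∑' i, complexityWeight (K i) / complexityWeight (K i₀)) ?_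
      (ENNReal.tsum_le_tsum fun i => ?_)
    · simp_rw [div_eq_mul_inv]
      rw [ENNReal.tsum_mul_right]
      exact ENNReal.mul_ne_top hK.tsum_ofReal_ne_top
        (ENNReal.inv_ne_top.2 (complexityWeight_ne_zero _))
    · have h := measure_exists_mul_density_le (interactionLaw π (ν i₀)) (interactionLaw π (ν i))
        (cycleFiltration Y O) measurable_firstCycles hℱ (hD i₀) (hD i) (hlaw i₀) (hlaw i)
        (w' := complexityWeight (K i)) (complexityWeight_ne_zero (K i₀))
        (complexityWeight_ne_top (K i₀))
      rwa [measure_univ, mul_one] at h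
  filter_upwards [hmerge, ae_finite_setOfPred_mem hsum] with ω hmerge hfin
  have hmem : ∀ i ℓ, complexityWeight (K i₀) * condDensity (q i₀) ℓ (firstCycles ω ℓ) ≤
      complexityWeight (K i) * condDensity (q i) ℓ (firstCycles ω ℓ) → i ∈ {i | ω ∈ {ω | ∃ n,
      complexityWeight (K i₀) * condDensity (q i₀) n (firstCycles ω n) ≤
        complexityWeight (K i) * condDensity (q i) n (firstCycles ω n)}} :=
    fun i ℓ h => ⟨ℓ, h⟩
  refine ⟨fun ℓ => exists_isMDL_of_finite i₀ hfin fun i => hmem i ℓ, fun mdl hmdl => ?_⟩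
  have hbest : ∀ ℓ, complexityWeight (K i₀) * condDensity (q i₀) ℓ (firstCycles ω ℓ) ≤
      complexityWeight (K (mdl ℓ)) * condDensity (q (mdl ℓ)) ℓ (firstCycles ω ℓ) := fun ℓ =>
    (codelength_le_codelength_iff _ _ _ _ _ _).1 (hmdl ℓ i₀)
  rw [Metric.tendsto_atTop']
  intro ε hε
  -- The selected index may keep changing, so each of the finitely many candidates gets its own
  -- threshold, and these are then combined.
  have hev : ∀ᶠ ℓ in atTop, ∀ i ∈ {i | ω ∈ {ω | ∃ n,
      complexityWeight (K i₀) * condDensity (q i₀) n (firstCycles ω n) ≤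
        complexityWeight (K i) * condDensity (q i) n (firstCycles ω n)}}, mdl ℓ = i →
      dist (value γ π (ν i) ℓ (firstCycles ω ℓ) - value γ π (ν i₀) ℓ (firstCycles ω ℓ)) 0 < ε := by
    refine (eventually_all_finite hfin).2 fun i _ => ?_
    rcases hmerge i with h | h
    · filter_upwards [Metric.tendsto_nhds.1 h ε hε] with ℓ hℓ _
      rwa [dist_zero_right, ← norm_neg, neg_sub, ← dist_zero_right] at hℓ
    · have hwi := complexityWeight_ne_zero (K i)
      have hwit := complexityWeight_ne_top (K i)
      -- Below this ratio of weights the candidate is strictly worse than the truth, so it can no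
      -- longer be selected.
      have hc := h (complexityWeight (K i₀) / complexityWeight (K i))
        (ENNReal.div_ne_zero.2 ⟨complexityWeight_ne_zero _, hwit⟩)
        (ENNReal.div_ne_top (complexityWeight_ne_top _) hwi)
      filter_upwards [hc] with ℓ hℓ hi
      refine absurd (hi ▸ hbest ℓ) (not_le.2 ?_)
      rwa [← ENNReal.mul_div_right_comm, ENNReal.lt_div_iff_mul_lt (Or.inl hwi) (Or.inl hwit),
        mul_comm] at hℓ
  obtain ⟨N, hN⟩ := eventually_atTop.1 hev
  exact ⟨N, fun ℓ hℓ => hN ℓ hℓ.le (mdl ℓ) (hmem _ ℓ (hbest ℓ)) rfl⟩
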